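/- For a real number $\alpha$ and a real number $\beta\ge -1$ put $D_\beta=\mathbb C$ if $\beta>-1$ and $D_{-1}=\mathbb C\setminus\{-1\}$. Let $Y_{\alpha,\beta}$ be the class of all transcendental (i.e. non-rational) meromorphic functions $f$ in $\mathbb C$ such that the family $(f_h)_{|h|\ge 1}$ of functions $$f_h(z)=h^{-\alpha}f(h+h^{-\beta}z)$$ (for one, equivalently for any, determination of the powers $h^{-\alpha}$, $h^{-\beta}$) is normal in $D_\beta$, and such that no limit function $\lim_{n\to\infty} f_{h_n}$ with $h_n\to\infty$ is constant (finite or $\equiv\infty$) on $D_\beta$; here convergence is locally uniform in $D_\beta$ with respect to the spherical metric. Then every $f\in Y_{\alpha,\beta}$ satisfies $$m\Big(r,\frac1{f'}\Big)=\frac1{2\pi}\int_0^{2\pi}\log^+\frac1{|f'(re^{i\theta})|}\,d\theta=O(\log r)\qquad(r\to\infty).$$ -/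

import Mathlib

open Filter Set
open scoped Topology OnePoint

noncomputable section

namespace GenYosida

/-- The chordal metric on the Riemann sphere `OnePoint ℂ`. It is bi-Lipschitz equivalent to the
geodesic spherical metric, so that it yields the same notion of uniform convergence. -/
def chordalDist : OnePoint ℂ → OnePoint ℂ → ℝ
  | ∞, ∞ => 0
  | ∞, OnePoint.some w => 1 / Real.sqrt (1 + ‖w‖ ^ 2)
  | OnePoint.some z, ∞ => 1 / Real.sqrt (1 + ‖z‖ ^ 2)
  | OnePoint.some z, OnePoint.some w =>
      ‖z - w‖ / (Real.sqrt (1 + ‖z‖ ^ 2) * Real.sqrt (1 + ‖w‖ ^ 2))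

open Classical in
/-- A meromorphic function in normal form (analytic away from its poles), viewed as a map into
the Riemann sphere: it takes the value `∞` exactly at its poles. -/
def toSphere (f : ℂ → ℂ) (z : ℂ) : OnePoint ℂ :=
  if meromorphicOrderAt f z < 0 then ∞ else (f z : OnePoint ℂ)

/-- Convergence in `D`, uniform on compact subsets, with respect to the spherical metric. -/
def SphericallyTendsto (F : ℕ → ℂ → OnePoint ℂ) (G : ℂ → OnePoint ℂ) (D : Set ℂ) : Prop :=
  ∀ K ⊆ D, IsCompact K → ∀ ε > 0, ∀ᶠ n in atTop, ∀ z ∈ K, chordalDist (F n z) (G z) < ε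

/-- The functions `F i`, `i ∈ I`, form a normal family in `D`: every sequence of members has a
subsequence that converges in `D`, uniformly on compact subsets, in the spherical metric. -/
def IsNormalFamily {ι : Type*} (F : ι → ℂ → OnePoint ℂ) (I : Set ι) (D : Set ℂ) : Prop :=
  ∀ i : ℕ → ι, (∀ n, i n ∈ I) →
    ∃ φ : ℕ → ℕ, StrictMono φ ∧ ∃ G : ℂ → OnePoint ℂ, SphericallyTendsto (fun n => F (i (φ n))) G D

/-- The rescaled function `f_h(z) = h^{-α} f(h + h^{-β} z)`, with principal powers. Another
determination of the powers only changes `f_h(z)` to `c f_h(d z)` with `|c| = |d| = 1`. -/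
def rescale (α β : ℝ) (f : ℂ → ℂ) (h : ℂ) : ℂ → ℂ :=
  fun z => h ^ ((-α : ℝ) : ℂ) * f (h + h ^ ((-β : ℝ) : ℂ) * z)

/-- The domain of normality: `ℂ` for `β > -1`, and `ℂ ∖ {-1}` for `β = -1`. -/
def domain (β : ℝ) : Set ℂ := {z | β = -1 → z ≠ -1}

/-- `f` is a rational function. -/
def IsRational (f : ℂ → ℂ) : Prop :=
  ∃ p q : Polynomial ℂ, q ≠ 0 ∧ ∀ z, q.eval z ≠ 0 → f z = p.eval z / q.eval z

/-- The class `Y_{α,β}` of generalised Yosida functions (used for `β ≥ -1`). -/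
structure YosidaClass (α β : ℝ) (f : ℂ → ℂ) : Prop where
  /-- `f` is meromorphic in the plane (with the convention `f = 0` at the poles) -/
  meromorphic : MeromorphicNFOn f univ
  /-- `f` is transcendental -/
  transcendental : ¬ IsRational f
  /-- the family `(f_h)_{|h| ≥ 1}` is normal -/
  normal : IsNormalFamily (fun h : ℂ => toSphere (rescale α β f h)) {h | 1 ≤ ‖h‖} (domain β)
  /-- no limit function `lim f_{h_n}`, `h_n → ∞`, is constant (finite or infinite) -/
  nonconstant : ∀ (h : ℕ → ℂ) (G : ℂ → OnePoint ℂ), Tendsto (fun n => ‖h n‖) atTop atTop →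
    SphericallyTendsto (fun n => toSphere (rescale α β f (h n))) G (domain β) →
      ¬ ∃ c : OnePoint ℂ, ∀ z ∈ domain β, G z = c

end GenYosida

end

/-! Write `f_h` for `rescale α β f h`. The heart is a bound uniform in `h`: for large `|h|`, `log⁺
(1 / |f_h'|)` on the disc `|z| ≤ 1/2` is at most a constant plus boundedly many terms `log⁺ (1 / |z
- w|)` (`YosidaClass.exists_uniform_log_pole_bound`). Otherwise some `h_n → ∞` violate every such
bound, while a subsequence of `f_{h_n}` converges spherically to a nonconstant `G`. Near a point
where `G` is finite, the derivatives converge to a function `g'` that is not identically zero, and a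
holomorphic function close to `L (z - z₀)^m` is bounded below by a product of `m` linear factors
(`exists_multiset_lower_bound`). Where `G = ∞` the same applies to the inverses. Compactness of the
disc gives a contradiction.

The circle `|z| = r` is then cut into about `r^(1+β)` equal arcs, each inside the rescaled disc
about its midpoint `h`. Since `|f_h'| = |h|^(-(α+β)) |f'|`, undoing the scaling costs at most `|α+β|
log r`. A logarithmic pole contributes `O(r^(-(1+β)))` to the integral over an arc
(`integral_arc_le`), so all poles together contribute `O(1)`. -/

noncomputable section

namespace GenYosida

/-! ### The chordal metric in homogeneous coordinates. -/

/-- First homogeneous coordinate of a point of the sphere. -/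
def homFst : OnePoint ℂ → ℂ
  | ∞ => 1
  | OnePoint.some z => z

/-- Second homogeneous coordinate of a point of the sphere. -/
def homSnd : OnePoint ℂ → ℂ
  | ∞ => 0
  | OnePoint.some _ => 1

/-- The Euclidean norm of the homogeneous coordinates. -/
def homNorm (p : OnePoint ℂ) : ℝ := Real.sqrt (‖homFst p‖ ^ 2 + ‖homSnd p‖ ^ 2)

lemma homNorm_sq (p : OnePoint ℂ) : homNorm p ^ 2 = ‖homFst p‖ ^ 2 + ‖homSnd p‖ ^ 2 :=
  Real.sq_sqrt (by positivity)

@[simp] lemma homNorm_infty : homNorm ∞ = 1 := by simp [homNorm, homFst, homSnd]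

@[simp] lemma homNorm_coe (z : ℂ) : homNorm (z : OnePoint ℂ) = Real.sqrt (1 + ‖z‖ ^ 2) := by
  simp [homNorm, homFst, homSnd, add_comm]

lemma one_le_homNorm (p : OnePoint ℂ) : 1 ≤ homNorm p := by
  induction p using OnePoint.rec with
  | infty => simp
  | coe z => rw [homNorm_coe]; exact Real.one_le_sqrt.2 (by nlinarith [sq_nonneg ‖z‖])

lemma homNorm_pos (p : OnePoint ℂ) : 0 < homNorm p := one_pos.trans_le (one_le_homNorm p)

lemma norm_le_homNorm (z : ℂ) : ‖z‖ ≤ homNorm (z : OnePoint ℂ) := by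
  rw [homNorm_coe]; exact Real.le_sqrt_of_sq_le (by linarith)

lemma chordalDist_eq (p q : OnePoint ℂ) :
    chordalDist p q =
      ‖homFst p * homSnd q - homFst q * homSnd p‖ / (homNorm p * homNorm q) := by
  induction p using OnePoint.rec with
  | infty => induction q using OnePoint.rec with
    | infty => simp [chordalDist, homFst, homSnd]
    | coe w => rw [homNorm_coe, homNorm_infty]; simp [chordalDist, homFst, homSnd]
  | coe z => induction q using OnePoint.rec with
    | infty => rw [homNorm_coe, homNorm_infty]; simp [chordalDist, homFst, homSnd]
    | coe w => rw [homNorm_coe, homNorm_coe]; simp [chordalDist, homFst, homSnd]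

lemma chordalDist_nonneg (p q : OnePoint ℂ) : 0 ≤ chordalDist p q := by
  rw [chordalDist_eq]
  have := homNorm_pos p
  have := homNorm_pos q
  positivity

lemma chordalDist_comm (p q : OnePoint ℂ) : chordalDist p q = chordalDist q p := by
  rw [chordalDist_eq, chordalDist_eq, norm_sub_rev, mul_comm (homNorm p)]

lemma norm_hom_inner_le (p q : OnePoint ℂ) :
    ‖homFst p * star (homFst q) + homSnd p * star (homSnd q)‖ ≤ homNorm p * homNorm q := by
  refine (norm_add_le _ _).trans ?_
  rw [norm_mul, norm_mul, norm_star, norm_star]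
  refine abs_le_of_sq_le_sq' ?_ (mul_nonneg (homNorm_pos p).le (homNorm_pos q).le) |>.2
  rw [mul_pow, homNorm_sq, homNorm_sq]
  nlinarith [sq_nonneg (‖homFst p‖ * ‖homSnd q‖ - ‖homSnd p‖ * ‖homFst q‖)]

/-- With `p ∧ q` the determinant of the homogeneous coordinates, `(p ∧ q) |v|² = (p ∧ v) ⟨q, v⟩ + (v
∧ q) ⟨p, v⟩`; Cauchy–Schwarz bounds the inner products. -/
lemma chordalDist_triangle (p v q : OnePoint ℂ) :
    chordalDist p q ≤ chordalDist p v + chordalDist v q := by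
  have hp := homNorm_pos p
  have hq := homNorm_pos q
  have hv := homNorm_pos v
  have key : (homFst p * homSnd q - homFst q * homSnd p) * ((homNorm v ^ 2 : ℝ) : ℂ) =
      (homFst p * homSnd v - homFst v * homSnd p) *
        (homFst q * star (homFst v) + homSnd q * star (homSnd v)) +
      (homFst v * homSnd q - homFst q * homSnd v) *
        (homFst p * star (homFst v) + homSnd p * star (homSnd v)) := by
    rw [homNorm_sq]
    have h1 : ((‖homFst v‖ ^ 2 + ‖homSnd v‖ ^ 2 : ℝ) : ℂ) =
        homFst v * star (homFst v) + homSnd v * star (homSnd v) := by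
      push_cast
      rw [← Complex.mul_conj', ← Complex.mul_conj']
      rfl
    rw [h1]; ring
  have h2 : ‖homFst p * homSnd q - homFst q * homSnd p‖ * homNorm v ^ 2 ≤
      ‖homFst p * homSnd v - homFst v * homSnd p‖ * (homNorm q * homNorm v) +
      ‖homFst v * homSnd q - homFst q * homSnd v‖ * (homNorm p * homNorm v) := by
    have h3 := congrArg norm key
    rw [norm_mul, Complex.norm_real, Real.norm_of_nonneg (by positivity)] at h3
    rw [h3]
    refine (norm_add_le _ _).trans ?_
    rw [norm_mul, norm_mul]
    gcongr <;> apply norm_hom_inner_le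
  rw [chordalDist_eq, chordalDist_eq, chordalDist_eq, div_add_div _ _ (by positivity) (by positivity),
    div_le_div_iff₀ (by positivity) (by positivity)]
  nlinarith [mul_le_mul_of_nonneg_left h2 (by positivity : 0 ≤ homNorm p * homNorm q)]

lemma chordalDist_coe (z w : ℂ) : chordalDist z w =
    ‖z - w‖ / (homNorm (z : OnePoint ℂ) * homNorm (w : OnePoint ℂ)) := by
  rw [chordalDist_eq]; simp [homFst, homSnd]

lemma chordalDist_infty_right (p : OnePoint ℂ) (hp : p ≠ ∞) :
    chordalDist p ∞ = 1 / homNorm p := by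
  induction p using OnePoint.rec with
  | infty => exact absurd rfl hp
  | coe z => rw [chordalDist_eq]; simp [homFst, homSnd]

lemma norm_sub_eq_chordalDist_mul (z w : ℂ) : ‖z - w‖ =
    chordalDist z w * (homNorm (z : OnePoint ℂ) * homNorm (w : OnePoint ℂ)) := by
  rw [chordalDist_coe, div_mul_cancel₀]
  exact (mul_pos (homNorm_pos _) (homNorm_pos _)).ne'

lemma chordalDist_coe_le (z w : ℂ) : chordalDist z w ≤ ‖z - w‖ := by
  rw [norm_sub_eq_chordalDist_mul z w]
  exact le_mul_of_one_le_right (chordalDist_nonneg _ _)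
    (one_le_mul_of_one_le_of_one_le (one_le_homNorm _) (one_le_homNorm _))

lemma chordalDist_self (p : OnePoint ℂ) : chordalDist p p = 0 := by
  rw [chordalDist_eq]; simp

lemma exists_coe_of_chordalDist_infty {p : OnePoint ℂ} {c : ℝ} (hc : 0 < c)
    (h : c ≤ chordalDist p ∞) : ∃ w : ℂ, p = w ∧ homNorm p ≤ 1 / c := by
  have hp : p ≠ ∞ := by
    rintro rfl
    rw [chordalDist_self] at h
    linarith
  obtain ⟨w, rfl⟩ := OnePoint.ne_infty_iff_exists.1 hp
  refine ⟨w, rfl, ?_⟩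
  rw [chordalDist_infty_right _ hp] at h
  rwa [le_div_comm₀ (homNorm_pos _) hc]

/-! ### Inversion, and meromorphic functions as maps to the sphere. -/

/-- The inversion `z ↦ 1 / z` of the sphere. -/
def sphereInv : OnePoint ℂ → OnePoint ℂ
  | ∞ => ((0 : ℂ) : OnePoint ℂ)
  | OnePoint.some z => open Classical in if z = 0 then ∞ else ((z⁻¹ : ℂ) : OnePoint ℂ)

@[simp] lemma sphereInv_infty : sphereInv ∞ = ((0 : ℂ) : OnePoint ℂ) := rfl

@[simp] lemma sphereInv_zero : sphereInv ((0 : ℂ) : OnePoint ℂ) = ∞ := by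
  simp [sphereInv]

lemma sphereInv_coe {z : ℂ} (hz : z ≠ 0) : sphereInv (z : OnePoint ℂ) = ((z⁻¹ : ℂ) : OnePoint ℂ) := by
  simp [sphereInv, hz]

lemma sphereInv_sphereInv (p : OnePoint ℂ) : sphereInv (sphereInv p) = p := by
  induction p using OnePoint.rec with
  | infty => simp
  | coe z =>
    by_cases hz : z = 0
    · simp [hz]
    · rw [sphereInv_coe hz, sphereInv_coe (inv_ne_zero hz), inv_inv]

lemma hom_sphereInv (p : OnePoint ℂ) : ∃ c : ℂ, c ≠ 0 ∧ homFst (sphereInv p) = c * homSnd p ∧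
    homSnd (sphereInv p) = c * homFst p := by
  induction p using OnePoint.rec with
  | infty => exact ⟨1, by simp [homFst, homSnd]⟩
  | coe z =>
    by_cases hz : z = 0
    · subst hz; exact ⟨1, by simp [homFst, homSnd]⟩
    · rw [sphereInv_coe hz]
      exact ⟨z⁻¹, by simp [homFst, homSnd, hz]⟩

/-- Inversion swaps the homogeneous coordinates up to a nonzero factor, which cancels in the
quotient. -/
lemma chordalDist_sphereInv (p q : OnePoint ℂ) :
    chordalDist (sphereInv p) (sphereInv q) = chordalDist p q := by
  obtain ⟨c, hc, h1, h2⟩ := hom_sphereInv p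
  obtain ⟨d, hd, h3, h4⟩ := hom_sphereInv q
  have hN : ∀ {p : OnePoint ℂ} {c : ℂ}, homFst (sphereInv p) = c * homSnd p →
      homSnd (sphereInv p) = c * homFst p → homNorm (sphereInv p) = ‖c‖ * homNorm p := by
    intro p c h1 h2
    rw [homNorm, h1, h2, homNorm, norm_mul, norm_mul, mul_pow, mul_pow, ← mul_add,
      Real.sqrt_mul (by positivity), Real.sqrt_sq (norm_nonneg _), add_comm]
  rw [chordalDist_eq, hN h1 h2, hN h3 h4, h1, h2, h3, h4, chordalDist_eq p q]
  have : c * homSnd p * (d * homFst q) - d * homSnd q * (c * homFst p) =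
      -(c * d * (homFst p * homSnd q - homFst q * homSnd p)) := by ring
  rw [this, norm_neg, norm_mul, norm_mul]
  have := homNorm_pos p
  have := homNorm_pos q
  have := norm_pos_iff.2 hc
  have := norm_pos_iff.2 hd
  field_simp

lemma toSphere_of_analyticAt {f : ℂ → ℂ} {z : ℂ} (h : AnalyticAt ℂ f z) :
    toSphere f z = (f z : OnePoint ℂ) := by
  rw [toSphere, if_neg (not_lt.2 h.meromorphicOrderAt_nonneg)]

lemma analyticAt_of_toSphere_ne_infty {f : ℂ → ℂ} {z : ℂ} (hf : MeromorphicNFAt f z)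
    (h : toSphere f z ≠ ∞) : AnalyticAt ℂ f z := by
  rw [← hf.meromorphicOrderAt_nonneg_iff_analyticAt]
  by_contra h'
  exact h (by rw [toSphere, if_pos (not_le.1 h')])

/-- Infinite order must be excluded: if `f` vanishes near `z`, so does `f⁻¹`, whereas the inversion
sends `0` to `∞`. -/
lemma toSphere_inv {f : ℂ → ℂ} {z : ℂ} (hf : MeromorphicNFAt f z)
    (hz : meromorphicOrderAt f z ≠ ⊤) :
    toSphere f⁻¹ z = sphereInv (toSphere f z) := by
  rcases lt_trichotomy (meromorphicOrderAt f z) 0 with h | h | h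
  · have h0 : f z = 0 := by
      rcases meromorphicNFAt_iff_analyticAt_or.1 hf with h' | h'
      · exact absurd h'.meromorphicOrderAt_nonneg (not_le.2 h)
      · exact h'.2.2
    have h1 : ¬ meromorphicOrderAt f⁻¹ z < 0 := by
      rw [meromorphicOrderAt_inv, not_lt]
      cases hm : meromorphicOrderAt f z with
      | top => simp
      | coe n =>
        rw [hm] at h
        have : n < 0 := by exact_mod_cast h
        have h2 : (0 : ℤ) ≤ -n := by omega
        exact_mod_cast h2
    simp [toSphere, h, h1, h0]
  · have h0 := hf.meromorphicOrderAt_eq_zero_iff.1 h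
    rw [toSphere, toSphere, meromorphicOrderAt_inv, h]
    simp [sphereInv_coe h0]
  · have h0 : f z = 0 := by
      by_contra h'
      exact h.ne' (hf.meromorphicOrderAt_eq_zero_iff.2 h')
    rw [toSphere, toSphere, meromorphicOrderAt_inv, if_neg h.le.not_gt, h0, sphereInv_zero]
    cases hm : meromorphicOrderAt f z with
    | top => exact absurd hm hz
    | coe n =>
      rw [hm] at h
      have : 0 < n := by exact_mod_cast h
      have h2 : -n < (0 : ℤ) := by omega
      rw [if_pos]
      exact_mod_cast h2

/-! ### Spherical limits of meromorphic functions. -/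

/-- Meromorphic in the plane, in normal form, and not identically zero. -/
def IsNonzeroNF (f : ℂ → ℂ) : Prop :=
  ∀ z, MeromorphicNFAt f z ∧ meromorphicOrderAt f z ≠ ⊤

lemma IsNonzeroNF.inv {f : ℂ → ℂ} (hf : IsNonzeroNF f) : IsNonzeroNF f⁻¹ := by
  refine fun z => ⟨(hf z).1.inv, ?_⟩
  rw [meromorphicOrderAt_inv]
  intro h
  apply (hf z).2
  cases hm : meromorphicOrderAt f z with
  | top => rfl
  | coe n =>
    rw [hm] at h
    exact absurd h (by exact_mod_cast WithTop.coe_ne_top)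

lemma tendsto_chordalDist_of_analyticAt {f : ℂ → ℂ} {z : ℂ} (h : AnalyticAt ℂ f z) :
    Tendsto (fun w => chordalDist (toSphere f w) (toSphere f z)) (𝓝 z) (𝓝 0) := by
  have h1 : Tendsto (fun w => ‖f w - f z‖) (𝓝 z) (𝓝 0) := by
    have := (h.continuousAt.sub (continuousAt_const (y := f z))).norm
    simpa [ContinuousAt] using this
  refine tendsto_of_tendsto_of_tendsto_of_le_of_le' tendsto_const_nhds h1
    (Eventually.of_forall fun w => chordalDist_nonneg _ _) ?_
  filter_upwards [h.eventually_analyticAt] with w hw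
  rw [toSphere_of_analyticAt hw, toSphere_of_analyticAt h]
  exact chordalDist_coe_le _ _

lemma IsNonzeroNF.tendsto_chordalDist {f : ℂ → ℂ} (hf : IsNonzeroNF f) (z : ℂ) :
    Tendsto (fun w => chordalDist (toSphere f w) (toSphere f z)) (𝓝 z) (𝓝 0) := by
  by_cases h : toSphere f z = ∞
  · have h1 : toSphere f⁻¹ z ≠ ∞ := by
      rw [toSphere_inv (hf z).1 (hf z).2, h, sphereInv_infty]
      exact OnePoint.coe_ne_infty _
    refine (tendsto_chordalDist_of_analyticAt
      (analyticAt_of_toSphere_ne_infty (hf.inv z).1 h1)).congr fun w => ?_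
    rw [toSphere_inv (hf z).1 (hf z).2, toSphere_inv (hf w).1 (hf w).2, chordalDist_sphereInv]
  · exact tendsto_chordalDist_of_analyticAt (analyticAt_of_toSphere_ne_infty (hf z).1 h)

lemma SphericallyTendsto.inv {F : ℕ → ℂ → ℂ} (hF : ∀ n, IsNonzeroNF (F n)) {G : ℂ → OnePoint ℂ}
    {D : Set ℂ} (h : SphericallyTendsto (fun n => toSphere (F n)) G D) :
    SphericallyTendsto (fun n => toSphere (F n)⁻¹) (sphereInv ∘ G) D := by
  intro K hK hKc ε hε
  filter_upwards [h K hK hKc ε hε] with n hn z hz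
  rw [toSphere_inv (hF n z).1 (hF n z).2, Function.comp_apply, chordalDist_sphereInv]
  exact hn z hz

/-- Near a point where the spherical limit is finite, the convergence is uniform in the usual
sense. -/
lemma exists_ball_tendstoUniformlyOn {F : ℕ → ℂ → ℂ} (hF : ∀ n, IsNonzeroNF (F n))
    {G : ℂ → OnePoint ℂ} {D : Set ℂ} (hD : IsOpen D)
    (h : SphericallyTendsto (fun n => toSphere (F n)) G D) {z₀ : ℂ} (hz₀ : z₀ ∈ D)
    (hG : G z₀ ≠ ∞) :
    ∃ ρ > 0, ∃ g : ℂ → ℂ, ∃ M > 0, Metric.ball z₀ ρ ⊆ D ∧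
      (∀ z ∈ Metric.ball z₀ ρ, G z = g z) ∧ DifferentiableOn ℂ g (Metric.ball z₀ ρ) ∧
      TendstoUniformlyOn F g atTop (Metric.ball z₀ ρ) ∧
      ∀ᶠ n in atTop, ∀ z ∈ Metric.ball z₀ ρ, AnalyticAt ℂ (F n) z ∧ ‖F n z‖ ≤ M := by
  set κ := chordalDist (G z₀) ∞ with hκ
  have hκ0 : 0 < κ := by
    rw [hκ, chordalDist_infty_right _ hG]
    exact one_div_pos.2 (homNorm_pos _)
  obtain ⟨r, hr, hrD⟩ := Metric.nhds_basis_closedBall.mem_iff.1 (hD.mem_nhds hz₀)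
  have hev := h _ hrD (isCompact_closedBall z₀ r)
  -- `G` is not known to be continuous, so `G z` is compared with `G z₀` through `F N`. Three errors
  -- of `κ / 8` leave `κ / 2` for `G`; one more leaves `κ / 4` for `F n`.
  obtain ⟨N, hN⟩ := eventually_atTop.1 (hev (κ / 8) (by positivity))
  have hcont := (hF N).tendsto_chordalDist z₀
  obtain ⟨s, hs, hsball⟩ := Metric.nhds_basis_ball.mem_iff.1
    (hcont.eventually (gt_mem_nhds (show 0 < κ / 8 by positivity)))
  have hsub : Metric.ball z₀ (min r s) ⊆ Metric.closedBall z₀ r :=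
    (Metric.ball_subset_ball (min_le_left _ _)).trans Metric.ball_subset_closedBall
  have hlow : ∀ z ∈ Metric.ball z₀ (min r s), κ / 2 ≤ chordalDist (G z) ∞ := by
    intro z hz
    have h1 := hN N le_rfl z (hsub hz)
    have h2 : chordalDist (toSphere (F N) z) (toSphere (F N) z₀) < κ / 8 :=
      hsball (Metric.ball_subset_ball (min_le_right _ _) hz)
    have h3 := hN N le_rfl z₀ (Metric.mem_closedBall_self hr.le)
    have h4 := chordalDist_triangle (G z₀) (G z) ∞
    have h5 := chordalDist_triangle (G z₀) (toSphere (F N) z₀) (G z)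
    have h6 := chordalDist_triangle (toSphere (F N) z₀) (toSphere (F N) z) (G z)
    rw [chordalDist_comm] at h3
    rw [chordalDist_comm] at h2
    linarith
  have hlowF : ∀ n ≥ N, ∀ z ∈ Metric.ball z₀ (min r s),
      κ / 4 ≤ chordalDist (toSphere (F n) z) ∞ := by
    intro n hn z hz
    have h1 := hN n hn z (hsub hz)
    have h2 := hlow z hz
    have h3 := chordalDist_triangle (G z) (toSphere (F n) z) ∞
    rw [chordalDist_comm] at h1
    linarith
  have hg : ∀ z, ∃ w : ℂ, z ∈ Metric.ball z₀ (min r s) → G z = w ∧ homNorm (G z) ≤ 1 / (κ / 2) := by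
    intro z
    by_cases hz : z ∈ Metric.ball z₀ (min r s)
    · obtain ⟨w, hw⟩ := exists_coe_of_chordalDist_infty (by positivity) (hlow z hz)
      exact ⟨w, fun _ => hw⟩
    · exact ⟨0, fun h => absurd h hz⟩
  choose g hg using hg
  have hFa : ∀ n ≥ N, ∀ z ∈ Metric.ball z₀ (min r s), AnalyticAt ℂ (F n) z ∧
      homNorm (F n z : OnePoint ℂ) ≤ 1 / (κ / 4) := by
    intro n hn z hz
    obtain ⟨w, hw, hw'⟩ := exists_coe_of_chordalDist_infty (by positivity) (hlowF n hn z hz)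
    have ha := analyticAt_of_toSphere_ne_infty (hF n z).1 (hw ▸ OnePoint.coe_ne_infty w)
    exact ⟨ha, by rwa [toSphere_of_analyticAt ha] at hw'⟩
  have hunif : TendstoUniformlyOn F g atTop (Metric.ball z₀ (min r s)) := by
    rw [Metric.tendstoUniformlyOn_iff]
    intro ε hε
    -- Euclidean distance is chordal distance times the two `homNorm`s, here at most `4 / κ` and `2
    -- / κ`.
    filter_upwards [hev (ε * (κ / 4 * (κ / 2))) (by positivity), eventually_ge_atTop N] with n hn hnN z hz
    obtain ⟨ha, hb⟩ := hFa n hnN z hz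
    have h1 := hn z (hsub hz)
    obtain ⟨hc, hd⟩ := hg z hz
    rw [hc] at hd
    rw [hc] at h1
    simp only [toSphere_of_analyticAt ha] at h1
    rw [dist_comm, dist_eq_norm, norm_sub_eq_chordalDist_mul]
    have h2 : homNorm (F n z : OnePoint ℂ) * homNorm (g z : OnePoint ℂ) ≤
        1 / (κ / 4) * (1 / (κ / 2)) :=
      mul_le_mul hb hd (homNorm_pos _).le (by positivity)
    calc _ ≤ chordalDist (F n z) (g z) * (1 / (κ / 4) * (1 / (κ / 2))) :=
          mul_le_mul_of_nonneg_left h2 (chordalDist_nonneg _ _)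
      _ < ε * (κ / 4 * (κ / 2)) * (1 / (κ / 4) * (1 / (κ / 2))) :=
          mul_lt_mul_of_pos_right h1 (by positivity)
      _ = ε := by field_simp
  refine ⟨min r s, lt_min hr hs, g, 1 / (κ / 4), by positivity, hsub.trans hrD,
    fun z hz => (hg z hz).1, ?_, hunif, ?_⟩
  · refine hunif.tendstoLocallyUniformlyOn.differentiableOn ?_ Metric.isOpen_ball
    filter_upwards [eventually_ge_atTop N] with n hn z hz
    exact (hFa n hn z hz).1.differentiableAt.differentiableWithinAt
  · filter_upwards [eventually_ge_atTop N] with n hn z hz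
    exact ⟨(hFa n hn z hz).1, (norm_le_homNorm _).trans (hFa n hn z hz).2⟩

lemma eventuallyEq_const_of_frequently {g : ℂ → ℂ} {z₀ : ℂ} (hg : AnalyticAt ℂ g z₀) {c : ℂ}
    (h : ∃ᶠ z in 𝓝[≠] z₀, g z = c) : ∀ᶠ z in 𝓝 z₀, g z = c :=
  (hg.frequently_eq_iff_eventually_eq analyticAt_const).1 h

/-- The identity theorem for a holomorphic local representative of the limit; where `G z₀ = ∞` it is
applied after inversion. -/
lemma sphericalLimit_eventually_eq {F : ℕ → ℂ → ℂ} (hF : ∀ n, IsNonzeroNF (F n))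
    {G : ℂ → OnePoint ℂ} {D : Set ℂ} (hD : IsOpen D)
    (h : SphericallyTendsto (fun n => toSphere (F n)) G D) {z₀ : ℂ} (hz₀ : z₀ ∈ D)
    {c : OnePoint ℂ} (hc : ∃ᶠ z in 𝓝[≠] z₀, G z = c) : ∀ᶠ z in 𝓝 z₀, G z = c := by
  have key : ∀ {F : ℕ → ℂ → ℂ} (_ : ∀ n, IsNonzeroNF (F n)) {G : ℂ → OnePoint ℂ}
      (_ : SphericallyTendsto (fun n => toSphere (F n)) G D) {c : OnePoint ℂ}
      (_ : ∃ᶠ z in 𝓝[≠] z₀, G z = c) (_ : G z₀ ≠ ∞), ∀ᶠ z in 𝓝 z₀, G z = c := by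
    intro F hF G h c hc hG
    obtain ⟨ρ, hρ, g, M, -, hM, hGg, hg, -, -⟩ := exists_ball_tendstoUniformlyOn hF hD h hz₀ hG
    have hball := Metric.ball_mem_nhds z₀ hρ
    have hev : ∀ᶠ z in 𝓝 z₀, G z = g z := by filter_upwards [hball] with z hz using hGg z hz
    have hc' : ∃ᶠ z in 𝓝[≠] z₀, G z = c ∧ G z = g z :=
      hc.and_eventually (hev.filter_mono nhdsWithin_le_nhds)
    obtain ⟨z₁, hz₁, hz₁'⟩ := hc'.exists
    have hg0 := hg.analyticAt hball
    have := eventuallyEq_const_of_frequently hg0 (c := g z₁) (hc'.mono fun z hz => by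
      have : (g z : OnePoint ℂ) = g z₁ := by rw [← hz.2, ← hz₁', hz.1, hz₁]
      exact OnePoint.coe_injective this)
    filter_upwards [this, hev] with z h1 h2
    rw [h2, h1, ← hz₁', hz₁]
  by_cases hG : G z₀ = ∞
  · have := key (fun n => (hF n).inv) (h.inv hF) (c := sphereInv c)
      (hc.mono fun z hz => by rw [Function.comp_apply, hz]) (by simp [hG])
    filter_upwards [this] with z hz
    rw [← sphereInv_sphereInv (G z), ← sphereInv_sphereInv c]
    exact congrArg sphereInv hz
  · exact key hF h hc hG

lemma sphericalLimit_eq_of_eventually_eq {F : ℕ → ℂ → ℂ} (hF : ∀ n, IsNonzeroNF (F n))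
    {G : ℂ → OnePoint ℂ} {D : Set ℂ} (hD : IsOpen D) (hDc : IsPreconnected D)
    (h : SphericallyTendsto (fun n => toSphere (F n)) G D) {z₀ : ℂ} (hz₀ : z₀ ∈ D)
    {c : OnePoint ℂ} (hc : ∀ᶠ z in 𝓝 z₀, G z = c) : ∀ z ∈ D, G z = c := by
  have hsub : D ⊆ {z | ∀ᶠ w in 𝓝 z, G w = c} := by
    refine hDc.subset_of_closure_inter_subset isOpen_setOfPred_eventually_nhds ⟨z₀, hz₀, hc⟩ ?_
    rintro z ⟨hz, hzD⟩
    refine sphericalLimit_eventually_eq hF hD h hzD ?_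
    -- Otherwise `G ≠ c` on a punctured neighbourhood of `z`, while `G = c` near some `w`
    -- arbitrarily close to `z`. Every point near `w` would then equal `z`.
    by_contra hcon
    rw [not_frequently] at hcon
    have h1 : ∃ᶠ w in 𝓝 z, w ∈ {z | ∀ᶠ w in 𝓝 z, G w = c} := mem_closure_iff_frequently.1 hz
    obtain ⟨w, hw, hw'⟩ := (h1.and_eventually (eventually_eventually_nhds.2
      (eventually_nhdsWithin_iff.1 hcon))).exists
    have h2 : ∀ᶠ u in 𝓝 w, u = z := by
      filter_upwards [hw, hw'] with u h3 h4
      by_contra h5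
      exact h4 h5 h3
    obtain ⟨u, hu, hu'⟩ := ((h2.filter_mono nhdsWithin_le_nhds).and
      (self_mem_nhdsWithin (a := w) (s := {w}ᶜ))).exists
    exact hu' (hu.trans h2.self_of_nhds.symm)
  exact fun z hz => (hsub hz).self_of_nhds

/-! ### Lower bounds for functions close to a polynomial. -/

/-- Taking the difference quotient at `p` replaces `Q` by its quotient by `X - p`, of degree one
less. This drives the induction on the degree below. -/
lemma dslope_sub_mul_eval {ψ : ℂ → ℂ} {p : ℂ} (hψ : DifferentiableAt ℂ ψ p) (Q : Polynomial ℂ)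
    (L z : ℂ) : dslope (fun z => ψ z - L * Q.eval z) p z =
      dslope ψ p z - L * (Q /ₘ (Polynomial.X - Polynomial.C p)).eval z := by
  have hQ := Q.modByMonic_add_div (Polynomial.X - Polynomial.C p)
  rw [Polynomial.modByMonic_X_sub_C_eq_C_eval] at hQ
  by_cases hz : z = p
  · subst hz
    rw [dslope_same, dslope_same, deriv_fun_sub hψ (by fun_prop), deriv_const_mul _ (by fun_prop),
      Polynomial.deriv]
    congr 2
    conv_lhs => rw [← hQ]
    simp
  · have h1 := congrArg (Polynomial.eval z) hQ
    simp only [Polynomial.eval_add, Polynomial.eval_C, Polynomial.eval_mul, Polynomial.eval_sub,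
      Polynomial.eval_X] at h1
    rw [dslope_of_ne _ hz, dslope_of_ne _ hz, slope_def_field, slope_def_field]
    have h2 : z - p ≠ 0 := sub_ne_zero.2 hz
    field_simp
    rw [← h1]
    ring

/-- A holomorphic function close to a constant multiple of a monic polynomial of degree `m` is
bounded below by a product of `m` linear factors. -/
lemma exists_multiset_lower_bound {z₀ L : ℂ} {R : ℝ} (hR : 0 < R) (m : ℕ) :
    ∀ {ψ : ℂ → ℂ} {Q : Polynomial ℂ} {κ : ℝ}, DifferentiableOn ℂ ψ (Metric.ball z₀ R) →
      Q.Monic → Q.natDegree = m → (∀ z ∈ Metric.ball z₀ R, ‖ψ z - L * Q.eval z‖ ≤ κ) →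
      κ * (4 / R) ^ m ≤ ‖L‖ / 2 → ∃ a : Multiset ℂ, Multiset.card a = m ∧
        ∀ z ∈ Metric.closedBall z₀ (R / 2),
          ‖L‖ / 2 / 2 ^ m * (a.map fun w => ‖z - w‖).prod ≤ ‖ψ z‖ := by
  have hsub : Metric.closedBall z₀ (R / 2) ⊆ Metric.ball z₀ R :=
    Metric.closedBall_subset_ball (by linarith)
  induction m with
  | zero =>
    intro ψ Q κ hψ hQ hdeg hle hκ
    refine ⟨0, rfl, fun z hz => ?_⟩
    have h1 := hle z (hsub hz)
    rw [hQ.natDegree_eq_zero.1 hdeg] at h1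
    have h2 := norm_sub_norm_le L (ψ z)
    rw [norm_sub_rev] at h2
    simp at h1 h2 hκ ⊢
    linarith
  | succ m ih =>
    intro ψ Q κ hψ hQ hdeg hle hκ
    -- A minimum point of `‖ψ‖` replaces a zero, so no zeros need be counted: `‖ψ z - ψ p‖ ≤ 2 ‖ψ
    -- z‖` lets the factor `z - p` be split off at the cost of a factor 2.
    obtain ⟨p, hp, hmin⟩ := (isCompact_closedBall z₀ (R / 2)).exists_isMinOn
      ⟨z₀, Metric.mem_closedBall_self (by linarith)⟩ (hψ.continuousOn.mono hsub).norm
    have hpat : DifferentiableAt ℂ ψ p :=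
      hψ.differentiableAt (Metric.isOpen_ball.mem_nhds (hsub hp))
    set Q₁ := Q /ₘ (Polynomial.X - Polynomial.C p)
    set η : ℂ → ℂ := fun z => ψ z - L * Q.eval z with hη
    have hηd : DifferentiableOn ℂ η (Metric.ball z₀ R) :=
      hψ.sub (by fun_prop)
    have hpball : Metric.ball p (R / 2) ⊆ Metric.ball z₀ R :=
      Metric.ball_subset_ball' (by have := Metric.mem_closedBall.1 hp; linarith)
    have hκ0 : 0 ≤ κ := (norm_nonneg _).trans (hle p (hsub hp))
    have hdiff : ∀ z ∈ Metric.ball z₀ R, ‖η z - η p‖ ≤ 2 * κ := fun z hz =>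
      (norm_sub_le _ _).trans (by linarith [hle z hz, hle p (hsub hp)])
    have hle₁ : ∀ z ∈ Metric.ball z₀ R, ‖dslope ψ p z - L * Q₁.eval z‖ ≤ κ * (4 / R) := by
      intro z hz
      -- The error `η` varies by at most `2κ`. Within `R / 2` of `p` the Schwarz lemma bounds its
      -- difference quotient; farther away the denominator is at least `R / 2`.
      have e : κ * (4 / R) = 2 * κ / (R / 2) := by field_simp; ring
      rw [← dslope_sub_mul_eval hpat, e]
      by_cases hzp : z ∈ Metric.ball p (R / 2)
      · refine Complex.norm_dslope_le_div_of_mapsTo_ball (hηd.mono hpball) ?_ hzp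
        intro w hw
        rw [Metric.mem_closedBall, dist_eq_norm]
        exact hdiff w (hpball hw)
      · rw [Metric.mem_ball, not_lt, dist_eq_norm] at hzp
        have hne : z ≠ p := by
          rintro rfl
          rw [sub_self, norm_zero] at hzp
          linarith
        rw [dslope_of_ne _ hne, slope_def_field, norm_div]
        exact div_le_div₀ (by positivity) (hdiff z hz) (by positivity) hzp
    obtain ⟨a, ha, hb⟩ := ih (ψ := dslope ψ p) (Q := Q₁) (κ := κ * (4 / R))
      ((Complex.differentiableOn_dslope (Metric.isOpen_ball.mem_nhds (hsub hp))).2 hψ)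
      ((Polynomial.leadingCoeff_divByMonic_X_sub_C Q (by
        rw [Polynomial.degree_eq_natDegree hQ.ne_zero, hdeg]
        exact_mod_cast Nat.succ_ne_zero m) p).trans hQ)
      (by rw [Polynomial.natDegree_divByMonic _ (Polynomial.monic_X_sub_C p), hdeg]; simp)
      hle₁ (by rw [mul_assoc, ← pow_succ']; exact hκ)
    refine ⟨p ::ₘ a, by simp [ha], fun z hz => ?_⟩
    have h1 : ‖ψ z - ψ p‖ ≤ 2 * ‖ψ z‖ := by
      have := hmin hz
      simp only [mem_ofPred_eq] at this
      linarith [norm_sub_le (ψ z) (ψ p)]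
    have h2 : ψ z - ψ p = (z - p) * dslope ψ p z := by
      have := sub_smul_dslope ψ p z
      rw [smul_eq_mul] at this
      exact this.symm
    rw [h2, norm_mul] at h1
    have h3 := mul_le_mul_of_nonneg_left (hb z hz) (norm_nonneg (z - p))
    rw [Multiset.map_cons, Multiset.prod_cons]
    have h4 : ‖L‖ / 2 / 2 ^ (m + 1) * (‖z - p‖ * (a.map fun w => ‖z - w‖).prod) =
        ‖z - p‖ * (‖L‖ / 2 / 2 ^ m * (a.map fun w => ‖z - w‖).prod) / 2 := by
      rw [pow_succ]; field_simp
    rw [h4]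
    linarith

lemma exists_monic_approx {ψ : ℂ → ℂ} {z₀ : ℂ} (hψ : AnalyticAt ℂ ψ z₀)
    (hne : ¬ ∀ᶠ z in 𝓝 z₀, ψ z = 0) : ∃ (m : ℕ) (L : ℂ) (Q : Polynomial ℂ), L ≠ 0 ∧ Q.Monic ∧
      Q.natDegree = m ∧ ∃ C > 0, ∀ᶠ z in 𝓝 z₀, ‖ψ z - L * Q.eval z‖ ≤ C * ‖z - z₀‖ ^ (m + 1) := by
  have htop : analyticOrderAt ψ z₀ ≠ ⊤ := by
    rwa [Ne, analyticOrderAt_eq_top]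
  obtain ⟨m, hm⟩ := ENat.ne_top_iff_exists.1 htop
  obtain ⟨u, hu, hu0, hev⟩ := (hψ.analyticOrderAt_eq_natCast).1 hm.symm
  refine ⟨m, u z₀, (Polynomial.X - Polynomial.C z₀) ^ m, hu0, (Polynomial.monic_X_sub_C z₀).pow m,
    by simp [(Polynomial.monic_X_sub_C z₀).natDegree_pow], ?_⟩
  obtain ⟨C, hC, hb⟩ := hu.differentiableAt.isBigO_sub.exists_pos
  refine ⟨C, hC, ?_⟩
  filter_upwards [hev, hb.bound] with z h1 h2
  rw [h1]
  simp only [Polynomial.eval_pow, Polynomial.eval_sub, Polynomial.eval_X, Polynomial.eval_C,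
    smul_eq_mul]
  rw [mul_comm (u z₀), ← mul_sub, norm_mul, norm_pow, pow_succ]
  nlinarith [mul_le_mul_of_nonneg_left h2 (pow_nonneg (norm_nonneg (z - z₀)) m)]

/-- If `ψ n → ψ` uniformly near `z₀` with `ψ` not identically zero, then the `ψ n` are eventually
bounded below near `z₀` by a fixed multiple of a product of a fixed number of linear factors. -/
lemma exists_eventually_lower_bound {ψ : ℂ → ℂ} {Ψ : ℕ → ℂ → ℂ} {z₀ : ℂ} {ρ : ℝ} (hρ : 0 < ρ)
    (hψ : DifferentiableOn ℂ ψ (Metric.ball z₀ ρ)) (hne : ¬ ∀ᶠ z in 𝓝 z₀, ψ z = 0)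
    (hΨ : ∀ᶠ n in atTop, DifferentiableOn ℂ (Ψ n) (Metric.ball z₀ ρ))
    (hlim : TendstoLocallyUniformlyOn Ψ ψ atTop (Metric.ball z₀ ρ)) :
    ∃ m : ℕ, ∃ c > 0, ∃ V ∈ 𝓝 z₀, ∀ᶠ n in atTop, ∃ a : Multiset ℂ, Multiset.card a = m ∧
      ∀ z ∈ V, c * (a.map fun w => ‖z - w‖).prod ≤ ‖Ψ n z‖ := by
  have hball := Metric.ball_mem_nhds z₀ hρ
  obtain ⟨m, L, Q, hL, hQ, hdeg, C, hC, hev⟩ := exists_monic_approx (hψ.analyticAt hball) hne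
  have hL' := norm_pos_iff.2 hL
  obtain ⟨s, hs, hsb⟩ := Metric.nhds_basis_ball.mem_iff.1 hev
  -- This `R` makes `C * R ^ (m + 1) * (4 / R) ^ m` at most `‖L‖ / 4`; the uniform error chosen
  -- below contributes the other `‖L‖ / 4`.
  set R := min (min s (ρ / 2)) (‖L‖ / (4 * C * 4 ^ m)) with hRdef
  have hR : 0 < R := by positivity
  have hRs : R ≤ s := (min_le_left _ _).trans (min_le_left _ _)
  have hRρ : R ≤ ρ / 2 := (min_le_left _ _).trans (min_le_right _ _)
  have hRC : R * (4 * C * 4 ^ m) ≤ ‖L‖ := by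
    rw [← le_div_iff₀ (by positivity)]
    exact min_le_right _ _
  have hRsub : Metric.closedBall z₀ R ⊆ Metric.ball z₀ ρ :=
    Metric.closedBall_subset_ball (by linarith)
  refine ⟨m, ‖L‖ / 2 / 2 ^ m, by positivity, Metric.closedBall z₀ (R / 2),
    Metric.closedBall_mem_nhds _ (by positivity), ?_⟩
  have hunif := (tendstoLocallyUniformlyOn_iff_forall_isCompact Metric.isOpen_ball).1 hlim _
    hRsub (isCompact_closedBall z₀ R)
  rw [Metric.tendstoUniformlyOn_iff] at hunif
  have hε : 0 < ‖L‖ / 4 * (R / 4) ^ m := by positivity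
  filter_upwards [hunif _ hε, hΨ] with n hn hd
  refine exists_multiset_lower_bound (κ := ‖L‖ / 4 * (R / 4) ^ m + C * R ^ (m + 1)) hR m
    (hd.mono (Metric.ball_subset_closedBall.trans hRsub)) hQ hdeg ?_ ?_
  · intro z hz
    have h1 := hn z (Metric.ball_subset_closedBall hz)
    rw [dist_comm, dist_eq_norm] at h1
    have h2 : ‖ψ z - L * Q.eval z‖ ≤ C * ‖z - z₀‖ ^ (m + 1) :=
      hsb (Metric.ball_subset_ball hRs hz)
    have h3 : ‖z - z₀‖ ^ (m + 1) ≤ R ^ (m + 1) := by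
      rw [Metric.mem_ball, dist_eq_norm] at hz
      gcongr
    have h4 := norm_add_le (Ψ n z - ψ z) (ψ z - L * Q.eval z)
    rw [sub_add_sub_cancel] at h4
    nlinarith [mul_le_mul_of_nonneg_left h3 hC.le]
  · have e1 : (R / 4) ^ m * (4 / R) ^ m = 1 := by
      rw [← mul_pow]; field_simp; simp
    have e2 : R ^ (m + 1) * (4 / R) ^ m = R * 4 ^ m := by
      rw [div_pow, pow_succ]; field_simp
    calc (‖L‖ / 4 * (R / 4) ^ m + C * R ^ (m + 1)) * (4 / R) ^ m
        = ‖L‖ / 4 * ((R / 4) ^ m * (4 / R) ^ m) + C * (R ^ (m + 1) * (4 / R) ^ m) := by ring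
      _ ≤ ‖L‖ / 2 := by rw [e1, e2]; nlinarith

/-! ### Logarithmic poles and their number on compact sets. -/

open Real in
/-- The sum of `log⁺ (1 / |z - w|)` over the points `w` of a multiset. -/
def posLogSum (a : Multiset ℂ) (z : ℂ) : ℝ := (a.map fun w => log⁺ ‖z - w‖⁻¹).sum

open Real in
lemma posLogSum_cons (w : ℂ) (a : Multiset ℂ) (z : ℂ) :
    posLogSum (w ::ₘ a) z = log⁺ ‖z - w‖⁻¹ + posLogSum a z := by
  simp [posLogSum]

lemma posLogSum_add (a b : Multiset ℂ) (z : ℂ) :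
    posLogSum (a + b) z = posLogSum a z + posLogSum b z := by
  simp [posLogSum]

lemma posLogSum_nonneg (a : Multiset ℂ) (z : ℂ) : 0 ≤ posLogSum a z := by
  refine Multiset.sum_nonneg fun x hx => ?_
  obtain ⟨w, -, rfl⟩ := Multiset.mem_map.1 hx
  exact Real.posLog_nonneg

open Real in
lemma posLog_inv_prod_le (a : Multiset ℂ) (z : ℂ) :
    log⁺ ((a.map fun w => ‖z - w‖).prod)⁻¹ ≤ posLogSum a z := by
  induction a using Multiset.induction with
  | empty => simp [posLogSum]
  | cons w a ih =>
    rw [posLogSum_cons, Multiset.map_cons, Multiset.prod_cons, mul_inv]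
    exact posLog_mul.trans (by linarith)

-- The points of `a` are excluded because `0⁻¹ = 0`: the term of `posLogSum` that should be infinite
-- there is `0`.
open Real in
lemma posLog_inv_le_of_lower_bound {a : Multiset ℂ} {z x : ℂ} {c : ℝ} (hc : 0 < c) (hz : z ∉ a)
    (h : c * (a.map fun w => ‖z - w‖).prod ≤ ‖x‖) :
    log⁺ ‖x⁻¹‖ ≤ log⁺ c⁻¹ + posLogSum a z := by
  have hprod : 0 < (a.map fun w => ‖z - w‖).prod := by
    apply Multiset.prod_pos
    intro y hy
    obtain ⟨w, hw, rfl⟩ := Multiset.mem_map.1 hy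
    exact norm_pos_iff.2 (sub_ne_zero.2 fun e => hz (e ▸ hw))
  rw [norm_inv]
  calc log⁺ ‖x‖⁻¹ ≤ log⁺ (c⁻¹ * ((a.map fun w => ‖z - w‖).prod)⁻¹) := by
        rw [← mul_inv]
        exact posLog_le_posLog (by positivity) (inv_anti₀ (by positivity) h)
    _ ≤ _ := posLog_mul.trans (by linarith [posLog_inv_prod_le a z])

lemma exists_eventually_deriv_lower_bound {F : ℕ → ℂ → ℂ} {g : ℂ → ℂ} {z₀ : ℂ} {ρ : ℝ}
    (hρ : 0 < ρ) (hg : DifferentiableOn ℂ g (Metric.ball z₀ ρ))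
    (hF : ∀ᶠ n in atTop, DifferentiableOn ℂ (F n) (Metric.ball z₀ ρ))
    (hlim : TendstoLocallyUniformlyOn F g atTop (Metric.ball z₀ ρ))
    (hne : ¬ ∀ᶠ z in 𝓝 z₀, g z = g z₀) :
    ∃ m : ℕ, ∃ c > 0, ∃ V ∈ 𝓝 z₀, ∀ᶠ n in atTop, ∃ a : Multiset ℂ, Multiset.card a = m ∧
      ∀ z ∈ V, c * (a.map fun w => ‖z - w‖).prod ≤ ‖deriv (F n) z‖ := by
  refine exists_eventually_lower_bound (Ψ := fun n => deriv (F n)) hρ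
    (hg.deriv Metric.isOpen_ball) ?_ ?_ (hlim.deriv hF Metric.isOpen_ball)
  · intro h
    obtain ⟨s, hs, hsb⟩ := Metric.nhds_basis_ball.mem_iff.1 h
    apply hne
    have hr : 0 < min s ρ := lt_min hs hρ
    filter_upwards [Metric.ball_mem_nhds z₀ hr] with z hz
    refine (convex_ball z₀ (min s ρ)).is_const_of_fderivWithin_eq_zero (𝕜 := ℂ)
      (hg.mono (Metric.ball_subset_ball (min_le_right _ _))) ?_ hz (Metric.mem_ball_self hr)
    intro w hw
    rw [fderivWithin_of_isOpen Metric.isOpen_ball hw]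
    have : deriv g w = 0 := hsb (Metric.ball_subset_ball (min_le_left _ _) hw)
    ext
    simp [this]
  · filter_upwards [hF] with n hn using hn.deriv Metric.isOpen_ball

/-- A nonzero `deriv` forces differentiability. If also `f z = 0`, then `f * f⁻¹` would tend to both
`0` and `1` at `z`. -/
lemma ne_zero_and_norm_deriv_inv {f : ℂ → ℂ} (hf : IsNonzeroNF f) {z : ℂ} (hz : deriv f z ≠ 0)
    (hi : AnalyticAt ℂ f⁻¹ z) : f z ≠ 0 ∧ ‖deriv f⁻¹ z‖ = ‖deriv f z‖ * ‖f⁻¹ z‖ ^ 2 := by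
  have hd : DifferentiableAt ℂ f z := by
    by_contra h
    exact hz (deriv_zero_of_not_differentiableAt h)
  have h0 : f z ≠ 0 := by
    intro h0
    have hev := (meromorphicOrderAt_ne_top_iff_eventually_ne_zero (hf z).1.meromorphicAt).1 (hf z).2
    have h1 : Tendsto (fun w => f w * f⁻¹ w) (𝓝[≠] z) (𝓝 (f z * f⁻¹ z)) :=
      (hd.continuousAt.mul hi.continuousAt).tendsto.mono_left nhdsWithin_le_nhds
    have h2 : Tendsto (fun w => f w * f⁻¹ w) (𝓝[≠] z) (𝓝 1) :=
      tendsto_const_nhds.congr' (by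
        filter_upwards [hev] with w hw
        simp [hw])
    have h3 := tendsto_nhds_unique h1 h2
    simp [h0] at h3
  refine ⟨h0, ?_⟩
  rw [(hd.hasDerivAt.inv h0).deriv]
  simp [div_eq_mul_inv]

open Real in
/-- Eventually, `log⁺ (1 / |F n'|)` is bounded on `S` by a constant plus a bounded number of
logarithmic poles. -/
def HasLogPoleBound (F : ℕ → ℂ → ℂ) (S : Set ℂ) : Prop :=
  ∃ M : ℕ, ∀ᶠ n in atTop, ∃ a : Multiset ℂ, Multiset.card a ≤ M ∧
    ∀ z ∈ S, z ∉ a → log⁺ ‖(deriv (F n) z)⁻¹‖ ≤ M + posLogSum a z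

/-- Where `G` is finite, the lower bound for the derivatives applies. Where `G = ∞`, it applies to
the inverses, and `|(1/F)'| = |F'| |1/F|² ≤ K² |F'|` transfers it to `F`. -/
lemma exists_nhds_hasLogPoleBound {F : ℕ → ℂ → ℂ} (hF : ∀ n, IsNonzeroNF (F n))
    {G : ℂ → OnePoint ℂ} {D : Set ℂ} (hD : IsOpen D) (hDc : IsPreconnected D)
    (h : SphericallyTendsto (fun n => toSphere (F n)) G D)
    (hG : ¬ ∃ c : OnePoint ℂ, ∀ z ∈ D, G z = c) {z₀ : ℂ} (hz₀ : z₀ ∈ D) :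
    ∃ V ∈ 𝓝 z₀, HasLogPoleBound F V := by
  have key : ∀ {F : ℕ → ℂ → ℂ} (_ : ∀ n, IsNonzeroNF (F n)) {G : ℂ → OnePoint ℂ}
      (_ : SphericallyTendsto (fun n => toSphere (F n)) G D)
      (_ : ¬ ∃ c : OnePoint ℂ, ∀ z ∈ D, G z = c) (_ : G z₀ ≠ ∞),
      ∃ m : ℕ, ∃ c > 0, ∃ K > 0, ∃ V ∈ 𝓝 z₀, ∀ᶠ n in atTop, (∀ z ∈ V, AnalyticAt ℂ (F n) z ∧
        ‖F n z‖ ≤ K) ∧ ∃ a : Multiset ℂ, Multiset.card a = m ∧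
        ∀ z ∈ V, c * (a.map fun w => ‖z - w‖).prod ≤ ‖deriv (F n) z‖ := by
    intro F hF G h hG hGz
    obtain ⟨ρ, hρ, g, K, hK, -, hGg, hg, hlim, hev⟩ :=
      exists_ball_tendstoUniformlyOn hF hD h hz₀ hGz
    obtain ⟨m, c, hc, V, hV, hVev⟩ := exists_eventually_deriv_lower_bound hρ hg
      (by filter_upwards [hev] with n hn z hz using
        (hn z hz).1.differentiableAt.differentiableWithinAt)
      hlim.tendstoLocallyUniformlyOn (by
        intro hcon
        refine hG ⟨g z₀, sphericalLimit_eq_of_eventually_eq hF hD hDc h hz₀ ?_⟩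
        filter_upwards [hcon, Metric.ball_mem_nhds z₀ hρ] with z h1 h2
        rw [hGg z h2, h1])
    refine ⟨m, c, hc, K, hK, V ∩ Metric.ball z₀ ρ, inter_mem hV (Metric.ball_mem_nhds z₀ hρ), ?_⟩
    filter_upwards [hev, hVev] with n h1 h2
    obtain ⟨a, ha, hb⟩ := h2
    exact ⟨fun z hz => h1 z hz.2, a, ha, fun z hz => hb z hz.1⟩
  by_cases hGz : G z₀ = ∞
  · obtain ⟨m, c, hc, K, hK, V, hV, hev⟩ := key (fun n => (hF n).inv) (h.inv hF) (by
      rintro ⟨c, hc⟩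
      refine hG ⟨sphereInv c, fun z hz => ?_⟩
      rw [← hc z hz, Function.comp_apply, sphereInv_sphereInv]) (by simp [hGz])
    refine ⟨V, hV, max m ⌈Real.posLog (c * (K ^ 2)⁻¹)⁻¹⌉₊, ?_⟩
    filter_upwards [hev] with n hn
    obtain ⟨h1, a, ha, hb⟩ := hn
    refine ⟨a, ha.trans_le (le_max_left _ _), fun z hz hza => ?_⟩
    -- This case includes the poles of `F n`, where `deriv` takes the default value `0`; the left
    -- side is then `log⁺ 0 = 0`.
    by_cases hd : deriv (F n) z = 0
    · rw [hd, inv_zero, norm_zero, Real.posLog_zero]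
      have := posLogSum_nonneg a z
      positivity
    · obtain ⟨h2, h3⟩ := ne_zero_and_norm_deriv_inv (hF n) hd (h1 z hz).1
      have h4 := hb z hz
      rw [h3] at h4
      have h5 : ‖deriv (F n) z‖ * ‖(F n)⁻¹ z‖ ^ 2 ≤ ‖deriv (F n) z‖ * K ^ 2 := by
        gcongr
        exact (h1 z hz).2
      refine (posLog_inv_le_of_lower_bound (c := c * (K ^ 2)⁻¹) (by positivity) hza ?_).trans ?_
      · rw [mul_right_comm, ← div_eq_mul_inv, div_le_iff₀ (by positivity)]
        exact h4.trans h5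
      · gcongr
        push_cast
        exact le_max_of_le_right (Nat.le_ceil _)
  · obtain ⟨m, c, hc, K, hK, V, hV, hev⟩ := key hF h hG hGz
    refine ⟨V, hV, max m ⌈Real.posLog c⁻¹⌉₊, ?_⟩
    filter_upwards [hev] with n hn
    obtain ⟨h1, a, ha, hb⟩ := hn
    refine ⟨a, ha.trans_le (le_max_left _ _), fun z hz hza => ?_⟩
    refine (posLog_inv_le_of_lower_bound hc hza (hb z hz)).trans ?_
    gcongr
    push_cast
    exact le_max_of_le_right (Nat.le_ceil _)

/-- The bound passes to unions by adding the constants and joining the multisets, so finitely many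
of the local bounds suffice. -/
lemma hasLogPoleBound_of_isCompact {F : ℕ → ℂ → ℂ} (hF : ∀ n, IsNonzeroNF (F n))
    {G : ℂ → OnePoint ℂ} {D : Set ℂ} (hD : IsOpen D) (hDc : IsPreconnected D)
    (h : SphericallyTendsto (fun n => toSphere (F n)) G D)
    (hG : ¬ ∃ c : OnePoint ℂ, ∀ z ∈ D, G z = c) {K : Set ℂ} (hK : IsCompact K) (hKD : K ⊆ D) :
    HasLogPoleBound F K := by
  refine hK.induction_on (p := HasLogPoleBound F) ?_ ?_ ?_ ?_
  · exact ⟨0, Eventually.of_forall fun n => ⟨0, by simp⟩⟩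
  · rintro s t hst ⟨M, hM⟩
    refine ⟨M, hM.mono ?_⟩
    rintro n ⟨a, ha, hb⟩
    exact ⟨a, ha, fun z hz => hb z (hst hz)⟩
  · rintro s t ⟨M, hM⟩ ⟨M', hM'⟩
    refine ⟨M + M', ?_⟩
    filter_upwards [hM, hM'] with n h1 h2
    obtain ⟨a, ha, hb⟩ := h1
    obtain ⟨a', ha', hb'⟩ := h2
    refine ⟨a + a', by rw [Multiset.card_add]; omega, fun z hz hza => ?_⟩
    rw [Multiset.mem_add, not_or] at hza
    have h3 := posLogSum_nonneg a z
    have h4 := posLogSum_nonneg a' z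
    rw [posLogSum_add]
    push_cast
    rcases hz with hz | hz
    · have := hb z hz hza.1
      have : (0 : ℝ) ≤ M' := by positivity
      linarith
    · have := hb' z hz hza.2
      have : (0 : ℝ) ≤ M := by positivity
      linarith
  · intro z hz
    obtain ⟨V, hV, hb⟩ := exists_nhds_hasLogPoleBound hF hD hDc h hG (hKD hz)
    exact ⟨V, mem_nhdsWithin_of_mem_nhds hV, hb⟩

/-! ### The rescaled family and the bound uniform in `h`. -/

lemma YosidaClass.isNonzeroNF {α β : ℝ} {f : ℂ → ℂ} (hf : YosidaClass α β f) : IsNonzeroNF f := by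
  refine fun z => ⟨hf.meromorphic (mem_univ z), fun hz => ?_⟩
  apply hf.transcendental
  have hall : ∀ w, meromorphicOrderAt f w = ⊤ := by
    intro w
    by_contra hw
    have hm : MeromorphicOn f univ := fun x hx => (hf.meromorphic hx).meromorphicAt
    exact hm.meromorphicOrderAt_ne_top_of_isPreconnected isPreconnected_univ (mem_univ w)
      (mem_univ z) hw hz
  refine ⟨0, 1, one_ne_zero, fun w _ => ?_⟩
  by_contra hw
  have h0 : f w ≠ 0 := by simpa using hw
  rw [← (hf.meromorphic (mem_univ w)).meromorphicOrderAt_eq_zero_iff, hall w] at h0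
  exact absurd h0 (by simp)

lemma IsNonzeroNF.rescale {f : ℂ → ℂ} (hf : IsNonzeroNF f) (α β : ℝ) {h : ℂ} (hh : h ≠ 0) :
    IsNonzeroNF (rescale α β f h) := by
  intro z
  have hc : h ^ ((-α : ℝ) : ℂ) ≠ 0 := by simp [Complex.cpow_eq_zero_iff, hh]
  have hd : h ^ ((-β : ℝ) : ℂ) ≠ 0 := by simp [Complex.cpow_eq_zero_iff, hh]
  have hNF : MeromorphicNFAt (GenYosida.rescale α β f h) z :=
    (MeromorphicNFAt.comp_analyticAt (g := fun z => h + h ^ ((-β : ℝ) : ℂ) * z) (hf _).1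
      (by fun_prop)).smul_analytic (g := fun _ => h ^ ((-α : ℝ) : ℂ)) analyticAt_const hc
  refine ⟨hNF, ?_⟩
  rw [meromorphicOrderAt_ne_top_iff_eventually_ne_zero hNF.meromorphicAt]
  have h1 := (meromorphicOrderAt_ne_top_iff_eventually_ne_zero
    (hf (h + h ^ ((-β : ℝ) : ℂ) * z)).1.meromorphicAt).1 (hf _).2
  have h2 : Tendsto (fun z => h + h ^ ((-β : ℝ) : ℂ) * z) (𝓝[≠] z)
      (𝓝[≠] (h + h ^ ((-β : ℝ) : ℂ) * z)) := by
    refine tendsto_nhdsWithin_of_tendsto_nhds_of_eventually_within _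
      ((by fun_prop : Continuous fun z => h + h ^ ((-β : ℝ) : ℂ) * z).tendsto z |>.mono_left
        nhdsWithin_le_nhds) ?_
    filter_upwards [self_mem_nhdsWithin] with w hw hw'
    exact hw (mul_left_cancel₀ hd (add_left_cancel hw'))
  filter_upwards [h2.eventually h1] with w hw
  exact mul_ne_zero hc hw

lemma isOpen_domain (β : ℝ) : IsOpen (domain β) := by
  by_cases h : β = -1
  · have : domain β = {(-1 : ℂ)}ᶜ := by ext; simp [domain, h]
    rw [this]
    exact isOpen_compl_singleton
  · have : domain β = univ := by ext; simp [domain, h]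
    rw [this]
    exact isOpen_univ

lemma isPreconnected_domain (β : ℝ) : IsPreconnected (domain β) := by
  by_cases h : β = -1
  · have : domain β = {(-1 : ℂ)}ᶜ := by ext; simp [domain, h]
    rw [this]
    exact (isConnected_compl_singleton_of_one_lt_rank
      (by rw [Complex.rank_real_complex]; norm_num) _).isPreconnected
  · have : domain β = univ := by ext; simp [domain, h]
    rw [this]
    exact isPreconnected_univ

/-- The radius `1/2` keeps the disc away from `-1`, the point removed when `β = -1`. -/
lemma closedBall_subset_domain (β : ℝ) : Metric.closedBall (0 : ℂ) (1 / 2) ⊆ domain β := by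
  rintro z hz - rfl
  norm_num at hz

open Real in
/-- The bound for `log⁺ (1 / |f_h'|)` is uniform in `h`. -/
lemma YosidaClass.exists_uniform_log_pole_bound {α β : ℝ} {f : ℂ → ℂ} (hf : YosidaClass α β f) :
    ∃ M : ℕ, ∀ h : ℂ, M ≤ ‖h‖ → ∃ a : Multiset ℂ, Multiset.card a ≤ M ∧
      ∀ z ∈ Metric.closedBall (0 : ℂ) (1 / 2), z ∉ a →
        log⁺ ‖(deriv (rescale α β f h) z)⁻¹‖ ≤ M + posLogSum a z := by
  by_contra! hcon
  choose h hh hbad using hcon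
  -- The shift by one discards `h 0`, which need not satisfy `1 ≤ ‖h 0‖`.
  have h1 : ∀ n, 1 ≤ ‖h (n + 1)‖ := fun n => by
    have := hh (n + 1)
    push_cast at this
    have : (0 : ℝ) ≤ n := by positivity
    linarith
  obtain ⟨φ, hφ, G, hG⟩ := hf.normal (fun n => h (n + 1)) h1
  have htend : Tendsto (fun n => ‖h (φ n + 1)‖) atTop atTop :=
    tendsto_atTop_mono (fun n => hh (φ n + 1))
      (tendsto_natCast_atTop_atTop.comp ((tendsto_add_atTop_nat 1).comp hφ.tendsto_atTop))
  have hNF : ∀ n, IsNonzeroNF (rescale α β f (h (φ n + 1))) := fun n =>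
    hf.isNonzeroNF.rescale α β (norm_pos_iff.1 (one_pos.trans_le (h1 (φ n))))
  obtain ⟨M, hM⟩ := hasLogPoleBound_of_isCompact hNF (isOpen_domain β) (isPreconnected_domain β) hG
    (hf.nonconstant _ G htend hG) (isCompact_closedBall 0 (1 / 2)) (closedBall_subset_domain β)
  obtain ⟨n, ⟨a, ha, hb⟩, hn⟩ := (hM.and (eventually_ge_atTop M)).exists
  have hle : M ≤ φ n + 1 := hn.trans ((hφ.id_le n).trans (Nat.le_succ _))
  obtain ⟨z, hz, hza, hlt⟩ := hbad (φ n + 1) a (ha.trans hle)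
  have h2 := hb z hz hza
  have h3 : (M : ℝ) ≤ ((φ n + 1 : ℕ) : ℝ) := by exact_mod_cast hle
  linarith

/-! ### Integrals of logarithmic poles over arcs. -/

open Real in
lemma intervalIntegrable_posLog_inv (k τ u v : ℝ) :
    IntervalIntegrable (fun θ => log⁺ (k * |θ - τ|)⁻¹) MeasureTheory.volume u v := by
  have hm : MeromorphicOn (fun θ : ℝ => (k * (θ - τ))⁻¹) (uIcc u v) := fun x _ =>
    (AnalyticAt.meromorphicAt (by fun_prop) : MeromorphicAt (fun θ : ℝ => k * (θ - τ)) x).inv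
  refine hm.intervalIntegrable_posLog_norm.congr fun θ _ => ?_
  simp only [norm_inv, norm_mul, Real.norm_eq_abs]
  rw [← posLog_abs (k * |θ - τ|)⁻¹, abs_inv, abs_mul, abs_abs]

open Real in
/-- The integral of `log⁺ (1 / |x|)` over `[-1, 1]`. -/
def posLogConst : ℝ := ∫ x in (-1 : ℝ)..1, log⁺ |x|⁻¹

open Real in
lemma posLogConst_nonneg : 0 ≤ posLogConst :=
  intervalIntegral.integral_nonneg (by norm_num) fun _ _ => posLog_nonneg

-- The substitution `x = k (θ - τ)` maps the interval into `[-1, 1]`, since its image has length at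
-- most 1 and contains 0.
open Real in
lemma integral_posLog_inv_le {k τ u v : ℝ} (hk : 0 < k) (hτ : τ ∈ Icc u v)
    (huv : k * (v - u) ≤ 1) :
    ∫ θ in u..v, log⁺ (k * |θ - τ|)⁻¹ ≤ posLogConst / k := by
  have h1 : ∀ θ, log⁺ (k * |θ - τ|)⁻¹ = (fun x => log⁺ |x|⁻¹) (k * θ - k * τ) := fun θ => by
    simp only
    rw [← mul_sub, abs_mul, abs_of_pos hk]
  simp_rw [h1]
  rw [intervalIntegral.integral_comp_mul_sub (fun x => log⁺ |x|⁻¹) hk.ne', smul_eq_mul,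
    ← div_eq_inv_mul]
  gcongr
  refine intervalIntegral.integral_mono_interval (c := -1) (d := 1) ?_ ?_ ?_
    (Eventually.of_forall fun _ => posLog_nonneg) ?_
  · nlinarith [hτ.1, hτ.2, mul_le_mul_of_nonneg_left hτ.2 hk.le]
  · nlinarith [hτ.1.trans hτ.2]
  · nlinarith [hτ.1, mul_le_mul_of_nonneg_left hτ.1 hk.le]
  · simpa using intervalIntegrable_posLog_inv 1 0 (-1) 1

open Real in
lemma integral_sum_posLog_inv_le {k u v : ℝ} (hk : 0 < k) (huv : k * (v - u) ≤ 1)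
    (T : Multiset ℝ) (hT : ∀ τ ∈ T, τ ∈ Icc u v) :
    IntervalIntegrable (fun θ => (T.map fun τ => log⁺ (k * |θ - τ|)⁻¹).sum)
      MeasureTheory.volume u v ∧
    ∫ θ in u..v, (T.map fun τ => log⁺ (k * |θ - τ|)⁻¹).sum ≤
      Multiset.card T * (posLogConst / k) := by
  induction T using Multiset.induction with
  | empty => simp
  | cons τ T ih =>
    obtain ⟨h1, h2⟩ := ih fun σ hσ => hT σ (Multiset.mem_cons_of_mem hσ)
    have h3 := integral_posLog_inv_le hk (hT τ (Multiset.mem_cons_self τ T)) huv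
    have h4 := intervalIntegrable_posLog_inv k τ u v
    simp only [Multiset.map_cons, Multiset.sum_cons, Multiset.card_cons]
    refine ⟨h4.add h1, ?_⟩
    rw [intervalIntegral.integral_add h4 h1]
    push_cast
    linarith

open Real in
lemma integral_le_of_log_pole_bound {g : ℝ → ℝ} {k u v c : ℝ} (hk : 0 < k) (hle : u ≤ v)
    (huv : k * (v - u) ≤ 1) (hg : IntervalIntegrable g MeasureTheory.volume u v)
    (T : Multiset ℝ) (hT : ∀ τ ∈ T, τ ∈ Icc u v)
    (hb : ∀ θ ∈ Icc u v, θ ∉ T → g θ ≤ c + (T.map fun τ => log⁺ (k * |θ - τ|)⁻¹).sum) :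
    ∫ θ in u..v, g θ ≤ c * (v - u) + Multiset.card T * (posLogConst / k) := by
  obtain ⟨h1, h2⟩ := integral_sum_posLog_inv_le hk huv T hT
  have h3 : ∫ θ in u..v, g θ ≤ ∫ θ in u..v, (c + (T.map fun τ => log⁺ (k * |θ - τ|)⁻¹).sum) := by
    refine intervalIntegral.integral_mono_ae_restrict hle hg (intervalIntegrable_const.add h1) ?_
    have hfin : ∀ᵐ θ ∂(MeasureTheory.volume.restrict (Icc u v)), θ ∉ T := by
      have : {θ | θ ∈ T}.Finite := by
        refine T.toFinset.finite_toSet.subset fun θ hθ => ?_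
        simpa using hθ
      have h0 := this.measure_zero (MeasureTheory.volume.restrict (Icc u v))
      exact MeasureTheory.measure_eq_zero_iff_ae_notMem.1 h0
    filter_upwards [hfin, MeasureTheory.ae_restrict_mem measurableSet_Icc] with θ h4 h5
    exact hb θ h5 h4
  rw [intervalIntegral.integral_add intervalIntegrable_const h1,
    intervalIntegral.integral_const, smul_eq_mul] at h3
  linarith

lemma norm_exp_sub_exp (θ τ : ℝ) :
    ‖Complex.exp (θ * Complex.I) - Complex.exp (τ * Complex.I)‖ = |2 * Real.sin ((θ - τ) / 2)| := by
  have : Complex.exp (θ * Complex.I) - Complex.exp (τ * Complex.I) =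
      Complex.exp (τ * Complex.I) * (Complex.exp (Complex.I * ((θ - τ : ℝ) : ℂ)) - 1) := by
    rw [mul_sub, ← Complex.exp_add, mul_one]
    congr 2
    push_cast
    ring
  rw [this, norm_mul, Complex.norm_exp_ofReal_mul_I, one_mul,
    Complex.norm_exp_I_mul_ofReal_sub_one, Real.norm_eq_abs]

lemma norm_exp_sub_exp_le (θ τ : ℝ) :
    ‖Complex.exp (θ * Complex.I) - Complex.exp (τ * Complex.I)‖ ≤ |θ - τ| := by
  rw [norm_exp_sub_exp, abs_mul, abs_two]
  have := Real.abs_sin_le_abs (x := (θ - τ) / 2)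
  rw [abs_div, abs_two] at this
  linarith

lemma le_norm_exp_sub_exp {θ τ : ℝ} (h : |θ - τ| ≤ 1) :
    |θ - τ| / 2 ≤ ‖Complex.exp (θ * Complex.I) - Complex.exp (τ * Complex.I)‖ := by
  rw [norm_exp_sub_exp, abs_mul, abs_two]
  have h1 : |(θ - τ) / 2| = |θ - τ| / 2 := by rw [abs_div, abs_two]
  have h2 := Real.mul_abs_le_abs_sin (x := (θ - τ) / 2)
    (by rw [h1]; linarith [Real.pi_gt_three])
  rw [h1] at h2
  have h3 : (1 : ℝ) / 2 ≤ 2 / Real.pi := by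
    rw [div_le_div_iff₀ two_pos Real.pi_pos]
    linarith [Real.pi_le_four]
  nlinarith [abs_nonneg (θ - τ), mul_le_mul_of_nonneg_right h3 (abs_nonneg (θ - τ))]

/-- A parametrised arc on a short interval stays away from every point of the plane, linearly in the
distance to a suitable parameter. -/
lemma exists_param_dist_le {ω u v : ℝ} (hω : 0 ≤ ω) (hle : u ≤ v) (huv : v - u ≤ 1) {γ : ℝ → ℂ}
    (hγ : ∀ θ τ, ‖γ θ - γ τ‖ =
      ω * ‖Complex.exp (θ * Complex.I) - Complex.exp (τ * Complex.I)‖)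
    (hγc : Continuous γ) (w : ℂ) :
    ∃ τ ∈ Icc u v, ∀ θ ∈ Icc u v, ω / 4 * |θ - τ| ≤ ‖γ θ - w‖ := by
  -- With `γ τ` the point of the arc nearest to `w`, `‖γ θ - γ τ‖ ≤ 2 ‖γ θ - w‖`. As a chord is at
  -- least half its angle, the constant is `ω / 4`.
  obtain ⟨τ, hτ, hmin⟩ := isCompact_Icc.exists_isMinOn (nonempty_Icc.2 hle)
    (hγc.sub (continuous_const (y := w))).norm.continuousOn
  refine ⟨τ, hτ, fun θ hθ => ?_⟩
  have h1 : ‖γ τ - w‖ ≤ ‖γ θ - w‖ := hmin hθ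
  have h2 : ‖γ θ - γ τ‖ ≤ ‖γ θ - w‖ + ‖γ τ - w‖ := by
    rw [← sub_sub_sub_cancel_right _ _ w]
    exact norm_sub_le _ _
  have h3 := mul_le_mul_of_nonneg_left (le_norm_exp_sub_exp (θ := θ) (τ := τ) (by
    rw [abs_le]
    constructor <;> linarith [hθ.1, hθ.2, hτ.1, hτ.2])) hω
  rw [← hγ] at h3
  linarith

lemma deriv_rescale (α β : ℝ) (f : ℂ → ℂ) (h z : ℂ) : deriv (rescale α β f h) z =
    h ^ ((-α : ℝ) : ℂ) * (h ^ ((-β : ℝ) : ℂ) * deriv f (h + h ^ ((-β : ℝ) : ℂ) * z)) := by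
  unfold rescale
  rw [deriv_const_mul_field]
  congr 1
  rw [deriv_comp_mul_left (h ^ ((-β : ℝ) : ℂ)) (fun z => f (h + z)) z, smul_eq_mul,
    deriv_comp_const_add]

-- By the chain rule `|f_h'| = |h|^(-(α+β)) |f'|`; this is the only source of the `log r` term.
open Real in
lemma posLog_norm_inv_deriv_le (α β : ℝ) (f : ℂ → ℂ) {h : ℂ} (hh : 1 ≤ ‖h‖) (z : ℂ) :
    log⁺ ‖(deriv f (h + h ^ ((-β : ℝ) : ℂ) * z))⁻¹‖ ≤
      |α + β| * log ‖h‖ + log⁺ ‖(deriv (rescale α β f h) z)⁻¹‖ := by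
  have h0 : 0 < ‖h‖ := one_pos.trans_le hh
  have h1 : ‖(deriv f (h + h ^ ((-β : ℝ) : ℂ) * z))⁻¹‖ =
      ‖h‖ ^ (-(α + β)) * ‖(deriv (rescale α β f h) z)⁻¹‖ := by
    rw [deriv_rescale, norm_inv, norm_inv, norm_mul, norm_mul,
      Complex.norm_cpow_real, Complex.norm_cpow_real, neg_add,
      Real.rpow_add h0]
    have := Real.rpow_pos_of_pos h0 (-α)
    have := Real.rpow_pos_of_pos h0 (-β)
    simp only [mul_inv]
    field_simp
  rw [h1]
  refine posLog_mul.trans ?_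
  gcongr
  rw [posLog_apply, Real.log_rpow h0]
  refine max_le (by have := Real.log_nonneg hh; positivity) ?_
  exact mul_le_mul_of_nonneg_right (neg_le_abs _) (Real.log_nonneg hh)

open Real in
lemma integral_arc_le {α β : ℝ} {f : ℂ → ℂ} {M : ℕ} {r θ₀ s : ℝ} (hr : 1 ≤ r) (hs : 0 ≤ s)
    (hrs : r ^ (1 + β) * s ≤ 1 / 2) (hs2 : s ≤ 1 / 2)
    (hM : ∃ a : Multiset ℂ, Multiset.card a ≤ M ∧
      ∀ z ∈ Metric.closedBall (0 : ℂ) (1 / 2), z ∉ a →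
        log⁺ ‖(deriv (rescale α β f (circleMap 0 r θ₀)) z)⁻¹‖ ≤ M + posLogSum a z)
    (hint : IntervalIntegrable (fun θ => log⁺ ‖(deriv f (circleMap 0 r θ))⁻¹‖)
      MeasureTheory.volume (θ₀ - s) (θ₀ + s)) :
    ∫ θ in (θ₀ - s)..(θ₀ + s), log⁺ ‖(deriv f (circleMap 0 r θ))⁻¹‖ ≤
      (|α + β| * log r + M) * (2 * s) + M * (posLogConst / (r ^ (1 + β) / 4)) := by
  obtain ⟨a, ha, hb⟩ := hM
  have hr0 : 0 < r := one_pos.trans_le hr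
  set h : ℂ := circleMap 0 r θ₀ with hh
  have hnorm : ‖h‖ = r := by simp [hh, abs_of_pos hr0]
  have hh0 : h ≠ 0 := norm_pos_iff.1 (hnorm ▸ hr0)
  set ω := r ^ (1 + β) with hω
  have hω0 : 0 < ω := Real.rpow_pos_of_pos hr0 _
  -- The arc in the coordinate `z` of the rescaled disc. Each pole `w` is then replaced by a
  -- parameter `τ w` on the arc, making the bound one-dimensional.
  set γ : ℝ → ℂ := fun θ => h ^ ((β : ℝ) : ℂ) * (circleMap 0 r θ - h) with hγ
  have hγc : Continuous γ := by
    have := continuous_circleMap 0 r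
    fun_prop
  have hγd : ∀ θ τ, ‖γ θ - γ τ‖ =
      ω * ‖Complex.exp (θ * Complex.I) - Complex.exp (τ * Complex.I)‖ := by
    intro θ τ
    have : γ θ - γ τ = h ^ ((β : ℝ) : ℂ) *
        (r * (Complex.exp (θ * Complex.I) - Complex.exp (τ * Complex.I))) := by
      simp only [hγ, circleMap]
      ring
    rw [this, norm_mul, norm_mul, Complex.norm_cpow_real, hnorm, Complex.norm_real,
      Real.norm_of_nonneg hr0.le, hω, Real.rpow_add hr0, Real.rpow_one]
    ring
  have hγinv : ∀ θ, h + h ^ ((-β : ℝ) : ℂ) * γ θ = circleMap 0 r θ := by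
    intro θ
    have : h ^ ((-β : ℝ) : ℂ) * h ^ ((β : ℝ) : ℂ) = 1 := by
      rw [← Complex.cpow_add _ _ hh0]
      simp
    simp only [hγ]
    rw [← mul_assoc, this, one_mul, add_sub_cancel]
  have hγmem : ∀ θ ∈ Icc (θ₀ - s) (θ₀ + s), γ θ ∈ Metric.closedBall (0 : ℂ) (1 / 2) := by
    intro θ hθ
    have h0 : γ θ₀ = 0 := by simp [hγ, hh]
    have h1 := hγd θ θ₀
    rw [h0, sub_zero] at h1
    rw [mem_closedBall_zero_iff, h1]
    refine (mul_le_mul_of_nonneg_left ((norm_exp_sub_exp_le θ θ₀).trans ?_) hω0.le).trans hrs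
    rw [abs_le]
    constructor <;> linarith [hθ.1, hθ.2]
  have hex := fun w => exists_param_dist_le (u := θ₀ - s) (v := θ₀ + s) hω0.le (by linarith)
    (by linarith) hγd hγc w
  choose τ hτ hτd using hex
  have hlog : 0 ≤ log r := Real.log_nonneg hr
  have hmain := integral_le_of_log_pole_bound (c := |α + β| * log r + M) (k := ω / 4)
    (by positivity) (by linarith) (by linarith) hint (a.map τ)
    (by
      intro t ht
      obtain ⟨w, -, rfl⟩ := Multiset.mem_map.1 ht
      exact hτ w)
    (by
      intro θ hθ hθT
      have hpos : ∀ w ∈ a, 0 < ω / 4 * |θ - τ w| := fun w hw => by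
        have : θ - τ w ≠ 0 := sub_ne_zero.2 fun e => hθT (e ▸ Multiset.mem_map_of_mem τ hw)
        positivity
      have hza : γ θ ∉ a := fun hmem => by
        have h1 := hτd (γ θ) θ hθ
        have h2 := hpos _ hmem
        rw [sub_self, norm_zero] at h1
        linarith
      have h1 := posLog_norm_inv_deriv_le α β f (hnorm.symm ▸ hr : 1 ≤ ‖h‖) (γ θ)
      rw [hγinv, hnorm] at h1
      have h2 := hb (γ θ) (hγmem θ hθ) hza
      have h3 : posLogSum a (γ θ) ≤
          ((a.map τ).map fun t => log⁺ (ω / 4 * |θ - t|)⁻¹).sum := by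
        rw [Multiset.map_map]
        refine Multiset.sum_map_le_sum_map _ _ fun w hw => ?_
        exact posLog_le_posLog (by positivity) (inv_anti₀ (hpos w hw) (hτd w θ hθ))
      linarith)
  refine hmain.trans ?_
  rw [Multiset.card_map]
  have hA := posLogConst_nonneg
  have : (Multiset.card a : ℝ) ≤ M := by exact_mod_cast ha
  have e : θ₀ + s - (θ₀ - s) = 2 * s := by ring
  rw [e]
  gcongr

/-! ### Summation over the circle. -/

open Real in
lemma YosidaClass.exists_integral_posLog_le {α β : ℝ} (hβ : -1 ≤ β) {f : ℂ → ℂ}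
    (hf : YosidaClass α β f) : ∃ C > 0, ∃ R ≥ 1, ∀ r ≥ R,
      ∫ θ in (0 : ℝ)..(2 * π), log⁺ ‖(deriv f (circleMap 0 r θ))⁻¹‖ ≤
        2 * π * (|α + β| * log r) + C := by
  obtain ⟨M, hM⟩ := hf.exists_uniform_log_pole_bound
  have hA := posLogConst_nonneg
  -- Here `32 = 8 * 4`: at most `8 * ω` arcs, each with pole contribution at most `M * posLogConst *
  -- 4 / ω`. The `1` only ensures positivity.
  refine ⟨2 * π * M + 32 * M * posLogConst + 1, by positivity, max M 1, le_max_right _ _,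
    fun r hr => ?_⟩
  have hr1 : 1 ≤ r := (le_max_right _ _).trans hr
  have hr0 : 0 < r := one_pos.trans_le hr1
  have hrM : (M : ℝ) ≤ r := (le_max_left _ _).trans hr
  set ω := r ^ (1 + β) with hω
  have hω1 : 1 ≤ ω := Real.one_le_rpow hr1 (by linarith)
  -- Since `π ≤ 7 / 2`, half-arcs of angle `π / N` satisfy `ω * (π / N) ≤ 1 / 2`. Because `β ≥ -1`
  -- gives `ω ≥ 1`, rounding up keeps `N ≤ 8 * ω`.
  set N := ⌈7 * ω⌉₊ with hN
  have hN1 : 7 * ω ≤ N := Nat.le_ceil _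
  have hN2 : (N : ℝ) ≤ 8 * ω := by
    have := Nat.ceil_lt_add_one (show 0 ≤ 7 * ω by positivity)
    linarith
  have hN0 : (0 : ℝ) < N := by linarith
  set g : ℝ → ℝ := fun θ => log⁺ ‖(deriv f (circleMap 0 r θ))⁻¹‖ with hg
  have hint : ∀ u v, u ∈ Icc 0 (2 * π) → v ∈ Icc 0 (2 * π) →
      IntervalIntegrable g MeasureTheory.volume u v := by
    intro u v hu hv
    have hm : MeromorphicOn (deriv f)⁻¹ (Metric.sphere 0 |r|) := fun z _ =>
      (hf.meromorphic (mem_univ z)).meromorphicAt.deriv.inv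
    have h1 : IntervalIntegrable g MeasureTheory.volume 0 (2 * π) := hm.circleIntegrable_posLog_norm
    refine h1.mono_set ?_
    rw [uIcc_of_le (by positivity : (0 : ℝ) ≤ 2 * π)]
    exact uIcc_subset_Icc hu hv
  set t : ℕ → ℝ := fun j => 2 * π * j / N with ht
  have htmem : ∀ j ≤ N, t j ∈ Icc 0 (2 * π) := by
    intro j hj
    have : (j : ℝ) ≤ N := by exact_mod_cast hj
    refine ⟨by positivity, ?_⟩
    rw [ht, div_le_iff₀ hN0]
    gcongr
  have hsum := intervalIntegral.sum_integral_adjacent_intervals (f := g) (a := t) (n := N)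
    (fun k hk => hint _ _ (htmem k hk.le) (htmem (k + 1) hk))
  have e0 : t 0 = 0 := by simp [ht]
  have eN : t N = 2 * π := by simp [ht, hN0.ne']
  rw [e0, eN] at hsum
  rw [← hsum]
  have harc : ∀ j ∈ Finset.range N, ∫ θ in (t j)..(t (j + 1)), g θ ≤
      (|α + β| * log r + M) * (2 * (π / N)) + M * (posLogConst / (ω / 4)) := by
    intro j hj
    have hjN := Finset.mem_range.1 hj
    have e1 : t j = (t j + π / N) - π / N := by ring
    have e2 : t (j + 1) = (t j + π / N) + π / N := by
      simp only [ht]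
      push_cast
      ring
    have hi := hint _ _ (htmem j hjN.le) (htmem (j + 1) hjN)
    rw [e2] at hi ⊢
    nth_rewrite 1 [e1] at hi
    nth_rewrite 1 [e1]
    have hπ : π ≤ 7 / 2 := by linarith [Real.pi_lt_d2]
    refine integral_arc_le hr1 (by positivity) ?_ ?_ (hM _ ?_) hi
    · rw [← mul_div_assoc, div_le_iff₀ hN0]
      nlinarith
    · rw [div_le_iff₀ hN0]
      linarith
    · simpa [abs_of_pos hr0] using hrM
  refine (Finset.sum_le_sum harc).trans ?_
  rw [Finset.sum_const, Finset.card_range, nsmul_eq_mul, mul_add]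
  have e3 : (N : ℝ) * ((|α + β| * log r + M) * (2 * (π / N))) =
      2 * π * (|α + β| * log r) + 2 * π * M := by
    field_simp
  have e4 : (N : ℝ) * (M * (posLogConst / (ω / 4))) ≤ 32 * M * posLogConst := by
    calc (N : ℝ) * (M * (posLogConst / (ω / 4))) ≤ 8 * ω * (M * (posLogConst / (ω / 4))) := by
          gcongr
      _ = 32 * M * posLogConst := by field_simp; ring
  linarith

end GenYosida

end

/-- `m(r, 1/f') = O(log r)` as `r → ∞`, for every `f` in the class `Y_{α,β}`. -/
theorem theorem15 (α β : ℝ) (hβ : -1 ≤ β) (f : ℂ → ℂ) (hf : GenYosida.YosidaClass α β f) :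
    (fun r : ℝ => ValueDistribution.proximity (deriv f)⁻¹ ⊤ r) =O[Filter.atTop]
      (fun r : ℝ => Real.log r) := by
  obtain ⟨C, hC, R, hR, hb⟩ := hf.exists_integral_posLog_le hβ
  -- For `r ≥ e` one has `log r ≥ 1`, so the additive constant `C` is absorbed into `C * log r`.
  refine Asymptotics.IsBigO.of_bound (|α + β| + C) ?_
  filter_upwards [eventually_ge_atTop R, eventually_ge_atTop (Real.exp 1)] with r hr hre
  have hlog : 1 ≤ Real.log r := (Real.le_log_iff_exp_le ((Real.exp_pos 1).trans_le hre)).2 hre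
  have hπ := Real.pi_gt_three
  have h1 := hb r hr
  rw [ValueDistribution.proximity_top, Real.circleAverage, smul_eq_mul, norm_mul,
    Real.norm_of_nonneg (by positivity), Real.norm_of_nonneg (by linarith : 0 ≤ Real.log r),
    Real.norm_of_nonneg (intervalIntegral.integral_nonneg (by positivity)
      fun _ _ => Real.posLog_nonneg), ← div_eq_inv_mul, div_le_iff₀ (by positivity)]
  refine h1.trans ?_
  have h2 : C * 1 ≤ C * Real.log r * (2 * Real.pi) := by
    rw [mul_assoc]
    gcongr
    nlinarith
  linarith
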